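/- Let $(W,S)$ be a finite Coxeter system, and let $T=\bigcup_{w\in W}wSw^{-1}$ be its set of reflections. A parabolic subgroup of $W$ is a subgroup of the form $w\langle I\rangle w^{-1}$ with $I\subseteq S$ and $w\in W$; for $u\in W$, the parabolic closure $P(u)$ is the smallest parabolic subgroup of $W$ containing $u$. A parabolic subgroup $P$ is called involutive if there is $x\in W$ with $x^2=1$ and $P(x)=P$. Every parabolic subgroup $P$ is a Coxeter group with respect to its canonical set of generators $\{t\in T\mid N(t)\cap P=\{t\}\}$, where $N(w)=\{r\in T\mid \ell_S(rw)<\ell_S(w)\}$ for $w\in W$, and the longest element of $P$ is its unique element of maximal length with respect to these generators. Then for every $u\in W$ one has $u^2=1$ if and only if $u$ is the longest element of $P(u)$. In particular, for every involutive parabolic subgroup $P$ of $W$ there is a unique $u\in P$ such that $u^2=1$ and $P=P(u)$. -/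

import Mathlib

namespace CoxeterSystem

variable {B W : Type*} [Group W] {M : CoxeterMatrix B} (cs : CoxeterSystem M W)

/-- The standard parabolic subgroup `W_I`, generated by the simple reflections indexed by `I`. -/
def standardParabolic (I : Set B) : Subgroup W :=
  Subgroup.closure (cs.simple '' I)

/-- A parabolic subgroup is a conjugate `w W_I w⁻¹` of a standard parabolic subgroup. -/
def IsParabolic (P : Subgroup W) : Prop :=
  ∃ (w : W) (I : Set B), P = (cs.standardParabolic I).map (MulAut.conj w).toMonoidHom

/-- The parabolic closure `P(w)`: the intersection of all parabolic subgroups containing `w`. -/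
def parabolicClosure (w : W) : Subgroup W :=
  sInf {P : Subgroup W | cs.IsParabolic P ∧ w ∈ P}

/-- A parabolic subgroup is involutive if it is the parabolic closure of some `x` with
`x ^ 2 = 1`. -/
def IsInvolutive (P : Subgroup W) : Prop :=
  cs.IsParabolic P ∧ ∃ x : W, x ^ 2 = 1 ∧ cs.parabolicClosure x = P

/-- The canonical Coxeter generators of a reflection subgroup `P` (Dyer, Deodhar): the reflections
`t` with `N(t) ∩ P = {t}`, where `N(t)` is the set of left inversions of `t`. -/
def canonicalGenerators (P : Subgroup W) : Set W :=
  {t | cs.IsReflection t ∧ {r | cs.IsLeftInversion t r ∧ r ∈ P} = {t}}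

/-- The length of `x` with respect to the canonical Coxeter generators of `P`: the least number of
factors in an expression of `x` as a product of canonical generators of `P`. It is meant for `x` in
a reflection subgroup `P`, which is generated by its canonical generators. -/
noncomputable def lengthIn (P : Subgroup W) (x : W) : ℕ :=
  sInf {n | ∃ l : List W, (∀ t ∈ l, t ∈ cs.canonicalGenerators P) ∧ l.prod = x ∧ l.length = n}

/-- `u` is the longest element of `P`, viewed as a Coxeter group through its canonical generators:
every other element of `P` is strictly shorter. -/
def IsLongestElement (P : Subgroup W) (u : W) : Prop :=
  u ∈ P ∧ ∀ x ∈ P, x ≠ u → cs.lengthIn P x < cs.lengthIn P u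

end CoxeterSystem

namespace CoxeterSystem

variable {B W : Type*} [Group W] {M : CoxeterMatrix B} (cs : CoxeterSystem M W)

/-! ### The parity cocycle and strong exchange -/

/-! Modulo 2, inversion sets satisfy the cocycle rule N(xy) = N(x) + x N(y) x⁻¹
(`isLeftInversion_mul_iff`); this also yields strong exchange.

Let u² = 1. If a left descent s of u does not commute with u, then sus is shorter, so by induction u
is conjugate to an involution a commuting with all its left descents J. Such an a is central in W_J
and is its longest element. Write u = x a x⁻¹. Each s in J is an inversion of a commuting with a,
and the cocycle rule forces it into every parabolic subgroup containing a; hence P(u) = x W_J x⁻¹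
(`parabolicClosure_conj`). As a is central in W_J, x may be taken of minimal length in x W_J;
conjugation by x then carries J to the canonical generators and length to relative length
(`lengthIn_conj`), so u is longest in P(u).

Conversely, a longest element has the same relative length as its inverse, so it equals its inverse.
Uniqueness of longest elements gives the second claim. -/

open Classical in
/-- The action of the `i`-th simple reflection on `W × ZMod 2`: conjugation on the first factor,
and a sign change exactly at the reflection itself. -/
noncomputable def signedConj (i : B) : Function.End (W × ZMod 2) :=
  fun p ↦ (cs.simple i * p.1 * cs.simple i, p.2 + if p.1 = cs.simple i then 1 else 0)

open Classical in
theorem prod_map_signedConj_apply (ω : List B) (t : W) (e : ZMod 2) :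
    (ω.map cs.signedConj).prod (t, e) =
      (cs.wordProd ω * t * (cs.wordProd ω)⁻¹,
        e + ((cs.leftInvSeq ω).count (cs.wordProd ω * t * (cs.wordProd ω)⁻¹) : ZMod 2)) := by
  induction ω with
  | nil => simp [Function.End.one_def]
  | cons i ω ih =>
    rw [List.map_cons, List.prod_cons]
    change cs.signedConj i ((ω.map cs.signedConj).prod (t, e)) = _
    rw [ih]
    set r := cs.wordProd ω * t * (cs.wordProd ω)⁻¹ with hr
    have hconj : cs.wordProd (i :: ω) * t * (cs.wordProd (i :: ω))⁻¹ =
        MulAut.conj (cs.simple i) r := by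
      rw [hr, wordProd_cons, MulAut.conj_apply]; group
    have hcount : (cs.leftInvSeq (i :: ω)).count (MulAut.conj (cs.simple i) r) =
        (cs.leftInvSeq ω).count r + if r = cs.simple i then 1 else 0 := by
      rw [leftInvSeq, List.count_cons,
        List.count_map_of_injective _ _ (MulAut.conj (cs.simple i)).injective]
      congr 1
      have : cs.simple i = MulAut.conj (cs.simple i) r ↔ r = cs.simple i := by
        rw [MulAut.conj_apply, inv_simple]
        constructor
        · intro h
          have h' := congrArg (fun z ↦ cs.simple i * z * cs.simple i) h
          simpa [mul_assoc] using h'.symm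
        · intro h; simp [h]
      simp only [beq_iff_eq, this]
    rw [hconj, hcount]
    ext
    · simp [signedConj]
    · simp only [signedConj]
      push_cast
      ring

/-- The sequence has period `M i j`, because its `k`-th entry depends on `k` only through the `k`-th
power of a product of two simple reflections. Every reflection therefore occurs an even number of
times, and the signed action respects the Coxeter relations. -/
theorem leftInvSeq_alternatingWord_drop (i j : B) :
    (cs.leftInvSeq (alternatingWord i j (2 * M i j))).drop (M i j) =
      (cs.leftInvSeq (alternatingWord i j (2 * M i j))).take (M i j) := by
  apply List.ext_getElem
  · simp; lia
  · intro k h₁ h₂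
    simp only [List.length_take, length_leftInvSeq, length_alternatingWord] at h₂
    rw [List.getElem_drop, List.getElem_take,
      cs.getElem_leftInvSeq_alternatingWord i j _ _ (by lia),
      cs.getElem_leftInvSeq_alternatingWord i j _ _ (by lia),
      prod_alternatingWord_eq_mul_pow, prod_alternatingWord_eq_mul_pow]
    have e₁ : (2 * (M i j + k) + 1) / 2 = M i j + k := by lia
    have e₂ : (2 * k + 1) / 2 = k := by lia
    simp [e₁, e₂, pow_add]

theorem alternatingWord_map_prod {G : Type*} [Monoid G] (f : B → G) (i j : B) (m : ℕ) :
    ((alternatingWord i j (2 * m)).map f).prod = (f i * f j) ^ m := by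
  induction m with
  | zero => simp [alternatingWord]
  | succ m ih =>
    rw [show 2 * (m + 1) = 2 * m + 1 + 1 by ring, alternatingWord_succ, alternatingWord_succ]
    simp [ih, pow_succ]

theorem isLiftable_signedConj : M.IsLiftable cs.signedConj := by
  classical
  intro i j
  rw [← alternatingWord_map_prod]
  funext ⟨t, e⟩
  rw [prod_map_signedConj_apply]
  have hw : cs.wordProd (alternatingWord i j (2 * M i j)) = 1 := by
    rw [prod_alternatingWord_eq_mul_pow]; simp
  have hcount : ∀ r, ((cs.leftInvSeq (alternatingWord i j (2 * M i j))).count r : ZMod 2) = 0 := by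
    intro r
    rw [← List.take_append_drop (M i j) (cs.leftInvSeq (alternatingWord i j (2 * M i j))),
      leftInvSeq_alternatingWord_drop, List.count_append]
    push_cast
    exact CharTwo.add_self_eq_zero _
  rw [hw, hcount]
  simp [Function.End.one_def]

/-- The signed conjugation representation of `W` on `W × ZMod 2`. -/
noncomputable def signedConjHom : W →* Function.End (W × ZMod 2) :=
  cs.lift ⟨cs.signedConj, cs.isLiftable_signedConj⟩

theorem signedConjHom_wordProd (ω : List B) :
    cs.signedConjHom (cs.wordProd ω) = (ω.map cs.signedConj).prod := by
  induction ω with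
  | nil => simp
  | cons i ω ih =>
    rw [wordProd_cons, map_mul, ih, List.map_cons, List.prod_cons]
    congr 1
    exact cs.lift_apply_simple cs.isLiftable_signedConj i

/-- The parity of the number of occurrences of `t` in the left inversion sequence of any word
for `w`. -/
noncomputable def inversionParity (w t : W) : ZMod 2 :=
  (cs.signedConjHom w (w⁻¹ * t * w, 0)).2

open Classical in
theorem inversionParity_wordProd (ω : List B) (t : W) :
    cs.inversionParity (cs.wordProd ω) t = ((cs.leftInvSeq ω).count t : ZMod 2) := by
  rw [inversionParity, signedConjHom_wordProd, prod_map_signedConj_apply]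
  simp [mul_assoc]

theorem signedConjHom_apply (w t : W) (e : ZMod 2) :
    cs.signedConjHom w (t, e) = (w * t * w⁻¹, e + cs.inversionParity w (w * t * w⁻¹)) := by
  classical
  obtain ⟨ω, rfl⟩ := cs.wordProd_surjective w
  rw [inversionParity_wordProd, signedConjHom_wordProd, prod_map_signedConj_apply]

theorem inversionParity_mul (x y t : W) :
    cs.inversionParity (x * y) t =
      cs.inversionParity x t + cs.inversionParity y (x⁻¹ * t * x) := by
  rw [inversionParity, map_mul]
  change (cs.signedConjHom x (cs.signedConjHom y _)).2 = _
  rw [signedConjHom_apply, signedConjHom_apply]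
  have h₁ : y * ((x * y)⁻¹ * t * (x * y)) * y⁻¹ = x⁻¹ * t * x := by group
  have h₂ : x * (x⁻¹ * t * x) * x⁻¹ = t := by group
  simp only [h₁, h₂]
  ring

theorem inversionParity_one (t : W) : cs.inversionParity 1 t = 0 := by
  simp [inversionParity, Function.End.one_def]

theorem inversionParity_inv (x t : W) :
    cs.inversionParity x⁻¹ (x⁻¹ * t * x) = cs.inversionParity x t := by
  have h := cs.inversionParity_mul x x⁻¹ t
  rw [mul_inv_cancel, inversionParity_one] at h
  exact (CharTwo.add_eq_zero.mp h.symm).symm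

theorem inversionParity_simple_self (i : B) :
    cs.inversionParity (cs.simple i) (cs.simple i) = 1 := by
  classical
  rw [← wordProd_singleton, inversionParity_wordProd]
  simp

/-- For t = x s x⁻¹ the contributions of x and x⁻¹ cancel modulo 2, leaving that of s at itself. -/
theorem IsReflection.inversionParity_self {t : W} (ht : cs.IsReflection t) :
    cs.inversionParity t t = 1 := by
  obtain ⟨x, i, rfl⟩ := ht
  have h₁ : x⁻¹ * (x * cs.simple i * x⁻¹) * x = cs.simple i := by group
  have h₂ : (x * cs.simple i)⁻¹ * (x * cs.simple i * x⁻¹) * (x * cs.simple i) =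
      x⁻¹ * (x * cs.simple i * x⁻¹) * x := by simp [mul_assoc]
  rw [inversionParity_mul, inversionParity_mul, h₂, inversionParity_inv, h₁,
    inversionParity_simple_self, add_right_comm, CharTwo.add_self_eq_zero, zero_add]

theorem isLeftInversion_of_inversionParity {w t : W} (h : cs.inversionParity w t = 1) :
    cs.IsLeftInversion w t := by
  classical
  obtain ⟨ω, hω, rfl⟩ := cs.exists_isReduced w
  rw [inversionParity_wordProd] at h
  refine cs.isLeftInversion_of_mem_leftInvSeq hω (List.count_pos_iff.mp (Nat.pos_of_ne_zero ?_))
  intro h0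
  simp [h0] at h

theorem isLeftInversion_iff_inversionParity {w t : W} (ht : cs.IsReflection t) :
    cs.IsLeftInversion w t ↔ cs.inversionParity w t = 1 := by
  refine ⟨fun h ↦ ?_, cs.isLeftInversion_of_inversionParity⟩
  by_contra hne
  -- If the parity of w at t were 0, that of tw would be 1, so t would be an inversion of tw and not
  -- of w.
  refine ht.isLeftInversion_mul_right_iff.mp (cs.isLeftInversion_of_inversionParity ?_) h
  have h0 : cs.inversionParity w t = 0 := by
    generalize cs.inversionParity w t = z at hne
    revert z; decide
  have h₁ : t⁻¹ * t * t = t := by group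
  rw [inversionParity_mul, IsReflection.inversionParity_self cs ht, h₁, h0, add_zero]

theorem isReflection_inv_conj {t : W} (ht : cs.IsReflection t) (x : W) :
    cs.IsReflection (x⁻¹ * t * x) := by
  simpa using ht.conj x⁻¹

theorem isLeftInversion_mul_iff {t : W} (ht : cs.IsReflection t) (x y : W) :
    cs.IsLeftInversion (x * y) t ↔
      Xor (cs.IsLeftInversion x t) (cs.IsLeftInversion y (x⁻¹ * t * x)) := by
  rw [cs.isLeftInversion_iff_inversionParity ht, cs.isLeftInversion_iff_inversionParity ht,
    cs.isLeftInversion_iff_inversionParity (cs.isReflection_inv_conj ht x), inversionParity_mul]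
  generalize cs.inversionParity x t = a
  generalize cs.inversionParity y (x⁻¹ * t * x) = b
  revert a b; unfold Xor; decide

theorem isLeftInversion_inv_conj_iff {t : W} (ht : cs.IsReflection t) (x : W) :
    cs.IsLeftInversion x⁻¹ (x⁻¹ * t * x) ↔ cs.IsLeftInversion x t := by
  rw [cs.isLeftInversion_iff_inversionParity ht,
    cs.isLeftInversion_iff_inversionParity (cs.isReflection_inv_conj ht x), inversionParity_inv]

/-- The strong exchange property, for words that need not be reduced. -/
theorem mem_leftInvSeq_of_isLeftInversion {ω : List B} {t : W}
    (h : cs.IsLeftInversion (cs.wordProd ω) t) : t ∈ cs.leftInvSeq ω := by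
  classical
  have h' := (cs.isLeftInversion_iff_inversionParity h.1).mp h
  rw [inversionParity_wordProd] at h'
  refine List.count_pos_iff.mp (Nat.pos_of_ne_zero fun h0 ↦ ?_)
  simp [h0] at h'

theorem isLeftInversion_simple_iff {i : B} {t : W} :
    cs.IsLeftInversion (cs.simple i) t ↔ t = cs.simple i := by
  constructor
  · intro h
    have h' := cs.mem_leftInvSeq_of_isLeftInversion (ω := [i]) (by simpa using h)
    simpa using h'
  · rintro rfl
    simp [IsLeftInversion, isReflection_simple]

/-! ### Standard parabolic subgroups -/

theorem simple_mem_standardParabolic {J : Set B} {i : B} (hi : i ∈ J) :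
    cs.simple i ∈ cs.standardParabolic J :=
  Subgroup.subset_closure ⟨i, hi, rfl⟩

theorem wordProd_mem_standardParabolic {J : Set B} {ω : List B} (hω : ∀ i ∈ ω, i ∈ J) :
    cs.wordProd ω ∈ cs.standardParabolic J := by
  refine Subgroup.list_prod_mem _ fun x hx ↦ ?_
  obtain ⟨i, hi, rfl⟩ := List.mem_map.mp hx
  exact cs.simple_mem_standardParabolic (hω i hi)

theorem standardParabolic_induction_left {J : Set B} {p : W → Prop} (one : p 1)
    (mul_left : ∀ i ∈ J, ∀ w, p w → p (cs.simple i * w)) {h : W}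
    (hh : h ∈ cs.standardParabolic J) : p h := by
  induction hh using Subgroup.closure_induction_left with
  | one => exact one
  | mul_left x hx y _ ih => obtain ⟨i, hi, rfl⟩ := hx; exact mul_left i hi y ih
  | inv_mul_cancel x hx y _ ih =>
    obtain ⟨i, hi, rfl⟩ := hx; rw [inv_simple]; exact mul_left i hi y ih

theorem exists_isReduced_of_mem_standardParabolic {J : Set B} {h : W}
    (hh : h ∈ cs.standardParabolic J) :
    ∃ ω : List B, (∀ i ∈ ω, i ∈ J) ∧ cs.IsReduced ω ∧ h = cs.wordProd ω := by
  refine cs.standardParabolic_induction_left (J := J) (p := fun h ↦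
    ∃ ω : List B, (∀ i ∈ ω, i ∈ J) ∧ cs.IsReduced ω ∧ h = cs.wordProd ω) ?_ ?_ hh
  · exact ⟨[], by simp, by simp [IsReduced], by simp⟩
  · rintro i hi w ⟨ω, hωJ, hω, rfl⟩
    rcases cs.length_simple_mul (cs.wordProd ω) i with hl | hl
    · refine ⟨i :: ω, by simpa [hi] using hωJ, ?_, (cs.wordProd_cons i ω).symm⟩
      rw [IsReduced, wordProd_cons, hl, hω.eq, List.length_cons]
    -- Exchange deletes a letter, so the new word still uses only letters of `J`.
    · obtain ⟨j, hj, hji⟩ := List.mem_iff_getElem.mp (cs.mem_leftInvSeq_of_isLeftInversion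
        (ω := ω) (t := cs.simple i) ⟨cs.isReflection_simple i, by lia⟩)
      have he : cs.simple i * cs.wordProd ω = cs.wordProd (ω.eraseIdx j) := by
        rw [← getD_leftInvSeq_mul_wordProd, List.getD_eq_getElem _ 1 hj, hji]
      refine ⟨ω.eraseIdx j, fun k hk ↦ hωJ k (List.mem_of_mem_eraseIdx hk), ?_, he⟩
      rw [length_leftInvSeq] at hj
      have := List.length_eraseIdx_add_one hj
      have := hω.eq
      rw [IsReduced, ← he]
      lia

theorem mem_standardParabolic_of_mem_leftInvSeq {J : Set B} {ω : List B} (hω : ∀ i ∈ ω, i ∈ J)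
    {t : W} (ht : t ∈ cs.leftInvSeq ω) : t ∈ cs.standardParabolic J := by
  obtain ⟨k, hk, rfl⟩ := List.mem_iff_getElem.mp ht
  rw [length_leftInvSeq] at hk
  rw [cs.getElem_leftInvSeq ω k hk]
  have h₁ : cs.wordProd (ω.take k) ∈ cs.standardParabolic J :=
    cs.wordProd_mem_standardParabolic fun i hi ↦ hω i (List.mem_of_mem_take hi)
  exact mul_mem (mul_mem h₁ (cs.simple_mem_standardParabolic (hω _ (List.getElem_mem hk))))
    (inv_mem h₁)

theorem IsLeftInversion.mem_standardParabolic {J : Set B} {h t : W}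
    (hh : h ∈ cs.standardParabolic J) (ht : cs.IsLeftInversion h t) :
    t ∈ cs.standardParabolic J := by
  obtain ⟨ω, hωJ, -, rfl⟩ := cs.exists_isReduced_of_mem_standardParabolic hh
  exact cs.mem_standardParabolic_of_mem_leftInvSeq hωJ (cs.mem_leftInvSeq_of_isLeftInversion ht)

/-- If every element of `J` is a left descent of `u`, then every element of `W_J` is a prefix
of `u`. -/
theorem length_add_length_inv_mul {J : Set B} {u : W} (hu : ∀ i ∈ J, cs.IsLeftDescent u i) {h : W}
    (hh : h ∈ cs.standardParabolic J) : cs.length h + cs.length (h⁻¹ * u) = cs.length u := by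
  obtain ⟨ω, hωJ, hω, rfl⟩ := cs.exists_isReduced_of_mem_standardParabolic hh
  clear hh
  induction ω with
  | nil => simp
  | cons i ω ih =>
    have hω' : cs.IsReduced ω := by simpa using hω.drop 1
    have ih' := ih (fun k hk ↦ hωJ k (List.mem_cons_of_mem _ hk)) hω'
    set h := cs.wordProd ω with hh
    have hlen : cs.length (cs.simple i * h) = cs.length h + 1 := by
      have h₁ := hω.eq
      have h₂ := hω'.eq
      rw [wordProd_cons, ← hh] at h₁
      rw [← hh] at h₂
      rw [h₁, h₂, List.length_cons]
    -- The simple reflection inverts u but not h, so its conjugate by h⁻¹ must invert h⁻¹u.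
    have hinv : cs.IsLeftInversion (h * (h⁻¹ * u)) (cs.simple i) := by
      rw [mul_inv_cancel_left]
      exact ⟨cs.isReflection_simple i, hu i (hωJ i (by simp))⟩
    rw [cs.isLeftInversion_mul_iff (cs.isReflection_simple i)] at hinv
    have hnot : ¬ cs.IsLeftInversion h (cs.simple i) := fun h' ↦ by
      have := h'.2
      lia
    have hlt := (hinv.resolve_left fun h' ↦ hnot h'.1).1.2
    have he : h⁻¹ * cs.simple i * h * (h⁻¹ * u) = (cs.simple i * h)⁻¹ * u := by
      simp [mul_assoc]
    rw [he] at hlt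
    have hle := cs.length_mul_le (cs.simple i * h) ((cs.simple i * h)⁻¹ * u)
    rw [mul_inv_cancel_left] at hle
    rw [wordProd_cons]
    lia

theorem length_lt_of_mem_standardParabolic {J : Set B} {a h : W}
    (ha : ∀ i ∈ J, cs.IsLeftDescent a i) (hh : h ∈ cs.standardParabolic J) (hne : h ≠ a) :
    cs.length h < cs.length a := by
  have h₁ := cs.length_add_length_inv_mul ha hh
  have h₂ : cs.length (h⁻¹ * a) ≠ 0 := fun h0 ↦
    hne (inv_mul_eq_one.mp (cs.length_eq_zero_iff.mp h0))
  lia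

/-! ### Involutions -/

/-- An involution commuting with all its left descents lies in the standard parabolic subgroup
generated by them. -/
theorem mem_standardParabolic_leftDescents [Finite W] {u : W} (hu : u ^ 2 = 1)
    (hcomm : ∀ i, cs.IsLeftDescent u i → u * cs.simple i = cs.simple i * u) :
    u ∈ cs.standardParabolic {i | cs.IsLeftDescent u i} := by
  set J : Set B := {i | cs.IsLeftDescent u i} with hJ
  have hL : ∀ h ∈ cs.standardParabolic J, cs.length h + cs.length (h⁻¹ * u) = cs.length u :=
    fun h hh ↦ cs.length_add_length_inv_mul (fun i hi ↦ hi) hh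
  obtain ⟨a, ha, hmax⟩ := Set.exists_max_image (cs.standardParabolic J : Set W) cs.length
    (Set.toFinite _) ⟨1, one_mem _⟩
  by_cases hv : a⁻¹ * u = 1
  · rwa [← inv_mul_eq_one.mp hv]
  -- A right descent s of a⁻¹u is one of u, hence lies in `J` and commutes with u. Then (sa)⁻¹u =
  -- a⁻¹us is shorter than a⁻¹u, making sa longer than the maximal a.
  · obtain ⟨i, hi⟩ := cs.exists_rightDescent_of_ne_one hv
    have hi' : cs.length (a⁻¹ * u * cs.simple i) < cs.length (a⁻¹ * u) := hi
    have hui : u⁻¹ = u := inv_eq_of_mul_eq_one_left (by rw [← pow_two, hu])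
    have hiJ : i ∈ J := by
      rw [hJ, Set.mem_ofPred_eq, ← hui, isLeftDescent_inv_iff, IsRightDescent]
      have h₁ := cs.length_mul_le a (a⁻¹ * u * cs.simple i)
      have h₂ : a * (a⁻¹ * u * cs.simple i) = u * cs.simple i := by group
      rw [h₂] at h₁
      have := hL a ha
      lia
    have hsa := mul_mem (cs.simple_mem_standardParabolic hiJ) ha
    have h₁ := hL _ hsa
    have h₂ := hmax _ hsa
    have h₃ := hL a ha
    have h₄ : (cs.simple i * a)⁻¹ * u = a⁻¹ * u * cs.simple i := by
      rw [mul_inv_rev, inv_simple, mul_assoc, mul_assoc, hcomm i hiJ]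
    rw [h₄] at h₁
    lia

theorem length_conj_simple_lt {u : W} (hu : u ^ 2 = 1) {i : B} (hi : cs.IsLeftDescent u i)
    (hne : u * cs.simple i ≠ cs.simple i * u) :
    cs.length (cs.simple i * u * cs.simple i) < cs.length u := by
  have hui : u⁻¹ = u := inv_eq_of_mul_eq_one_left (by rw [← pow_two, hu])
  have hr : cs.IsRightDescent u i := by rwa [← hui, isRightDescent_inv_iff]
  have h : cs.IsLeftInversion (u * cs.simple i) (cs.simple i) := by
    rw [cs.isLeftInversion_mul_iff (cs.isReflection_simple i), isLeftInversion_simple_iff]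
    refine Or.inl ⟨⟨cs.isReflection_simple i, hi⟩, fun h ↦ hne ?_⟩
    nth_rw 1 [← h]
    group
  rw [mul_assoc]
  exact h.2.trans hr

/-- Every involution is conjugate to a longest element of a standard parabolic subgroup `W_J`
that is central in `W_J`. -/
theorem exists_conj_central_longest [Finite W] {u : W} (hu : u ^ 2 = 1) :
    ∃ (x a : W) (J : Set B), u = x * a * x⁻¹ ∧ a ∈ cs.standardParabolic J ∧
      (∀ i ∈ J, cs.IsLeftDescent a i) ∧ ∀ i ∈ J, a * cs.simple i = cs.simple i * a := by
  induction hn : cs.length u using Nat.strong_induction_on generalizing u with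
  | _ n ih =>
    by_cases hcomm : ∀ i, cs.IsLeftDescent u i → u * cs.simple i = cs.simple i * u
    · exact ⟨1, u, _, by simp, cs.mem_standardParabolic_leftDescents hu hcomm, fun i hi ↦ hi, hcomm⟩
    · push Not at hcomm
      obtain ⟨i, hi, hne⟩ := hcomm
      have hsq : (cs.simple i * u * cs.simple i) ^ 2 = 1 := by
        have h := (conj_pow (i := 2) (a := cs.simple i) (b := u))
        rw [inv_simple] at h
        rw [h, hu]; simp
      obtain ⟨x, a, J, hx, ha⟩ := ih _ (hn ▸ cs.length_conj_simple_lt hu hi hne) hsq rfl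
      refine ⟨cs.simple i * x, a, J, ?_, ha⟩
      rw [mul_inv_rev, inv_simple]
      calc u = cs.simple i * (cs.simple i * u * cs.simple i) * cs.simple i := by simp [mul_assoc]
        _ = _ := by rw [hx]; group

theorem commute_of_mem_standardParabolic {J : Set B} {a h : W}
    (hcomm : ∀ i ∈ J, a * cs.simple i = cs.simple i * a) (hh : h ∈ cs.standardParabolic J) :
    Commute a h := by
  refine cs.standardParabolic_induction_left (J := J) (Commute.one_right a) ?_ hh
  exact fun i hi w ih ↦ Commute.mul_right (hcomm i hi) ih

/-! ### Parabolic subgroups -/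

/-- The parabolic subgroup `x W_J x⁻¹`. -/
abbrev conjParabolic (x : W) (J : Set B) : Subgroup W :=
  (cs.standardParabolic J).map (MulAut.conj x).toMonoidHom

theorem conj_mem_conjParabolic_iff {x h : W} {J : Set B} :
    x * h * x⁻¹ ∈ cs.conjParabolic x J ↔ h ∈ cs.standardParabolic J := by
  constructor
  · rintro ⟨k, hk, hkx⟩
    have : k = h := by simpa using hkx
    exact this ▸ hk
  · exact fun hh ↦ ⟨h, hh, by simp⟩

theorem mem_conjParabolic_iff {x g : W} {J : Set B} :
    g ∈ cs.conjParabolic x J ↔ x⁻¹ * g * x ∈ cs.standardParabolic J := by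
  rw [← cs.conj_mem_conjParabolic_iff (x := x)]
  group

/-- Any parabolic subgroup contains the left inversions of its elements that commute with them. -/
theorem mem_conjParabolic_of_commute {w g t : W} {K : Set B} (hg : g ∈ cs.conjParabolic w K)
    (ht : cs.IsLeftInversion g t) (hc : Commute g t) : t ∈ cs.conjParabolic w K := by
  rw [mem_conjParabolic_iff] at hg ⊢
  set h := w⁻¹ * g * w with hh
  have hgh : g = w * (h * w⁻¹) := by rw [hh]; group
  have htr := cs.isReflection_inv_conj ht.1 w
  have ht' := ht.1
  -- In g = w h w⁻¹ the outer factors contribute equally at t because g commutes with t; they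
  -- cancel, leaving an inversion of h in W_K.
  rw [hgh, cs.isLeftInversion_mul_iff ht.1, cs.isLeftInversion_mul_iff htr] at ht
  have he : h⁻¹ * (w⁻¹ * t * w) * h = w⁻¹ * t * w := by
    have h₁ : g⁻¹ * t * g = t := by rw [mul_assoc, ← hc.eq, inv_mul_cancel_left]
    calc h⁻¹ * (w⁻¹ * t * w) * h = w⁻¹ * (g⁻¹ * t * g) * w := by rw [hh]; group
      _ = _ := by rw [h₁]
  rw [he, cs.isLeftInversion_inv_conj_iff ht'] at ht
  refine IsLeftInversion.mem_standardParabolic cs hg ?_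
  unfold Xor at ht
  tauto

/-- If `a` is central in `W_J` and has all elements of `J` as left descents, then the parabolic
closure of `x a x⁻¹` is `x W_J x⁻¹`. -/
theorem parabolicClosure_conj {x a : W} {J : Set B} (ha : a ∈ cs.standardParabolic J)
    (hdesc : ∀ i ∈ J, cs.IsLeftDescent a i)
    (hcomm : ∀ i ∈ J, a * cs.simple i = cs.simple i * a) :
    cs.parabolicClosure (x * a * x⁻¹) = cs.conjParabolic x J := by
  apply le_antisymm
  · exact sInf_le ⟨⟨x, J, rfl⟩, cs.conj_mem_conjParabolic_iff.mpr ha⟩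
  · refine le_sInf ?_
    rintro _ ⟨⟨w, K, rfl⟩, hw⟩
    rw [Subgroup.map_le_iff_le_comap, standardParabolic, Subgroup.closure_le]
    rintro _ ⟨i, hi, rfl⟩
    have h₁ : a ∈ cs.conjParabolic (x⁻¹ * w) K := by
      rw [mem_conjParabolic_iff] at hw ⊢
      convert hw using 1
      group
    have h₂ := cs.mem_conjParabolic_of_commute h₁ ⟨cs.isReflection_simple i, hdesc i hi⟩
      (hcomm i hi)
    change x * cs.simple i * x⁻¹ ∈ cs.conjParabolic w K
    rw [mem_conjParabolic_iff] at h₂ ⊢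
    convert h₂ using 1
    group

/-! ### Canonical generators and relative length for a minimal coset representative -/

section Minimal

variable {cs} {x : W} {J : Set B}
  (hx : ∀ h ∈ cs.standardParabolic J, cs.length x ≤ cs.length (x * h))
include hx

/-- By minimality of x, neither outer factor of x h x⁻¹ contributes to the cocycle at reflections
coming from W_J. -/
theorem isLeftInversion_conj_iff {h r : W} (hh : h ∈ cs.standardParabolic J)
    (hr : r ∈ cs.standardParabolic J) (hrefl : cs.IsReflection r) :
    cs.IsLeftInversion (x * h * x⁻¹) (x * r * x⁻¹) ↔ cs.IsLeftInversion h r := by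
  have h₀ : x⁻¹ * (x * r * x⁻¹) * x = r := by group
  rw [mul_assoc x h, cs.isLeftInversion_mul_iff (hrefl.conj x), h₀,
    cs.isLeftInversion_mul_iff hrefl]
  have h₁ : ¬ cs.IsLeftInversion x (x * r * x⁻¹) := fun h' ↦ by
    have := h'.2
    rw [inv_mul_cancel_right] at this
    exact absurd (hx r hr) (not_le.mpr this)
  have h₂ : ¬ cs.IsLeftInversion x⁻¹ (h⁻¹ * r * h) := fun h' ↦ by
    have := h'.2
    rw [← cs.length_inv, mul_inv_rev, inv_inv, cs.length_inv x] at this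
    exact absurd (hx _ (inv_mem (mul_mem (mul_mem (inv_mem hh) hr) hh))) (not_le.mpr this)
  unfold Xor
  tauto

/-- A left descent s of x⁻¹tx gives x s x⁻¹ in N(t) ∩ P = {t}. That `i` lies in `J` is not recorded,
since `lengthIn_conj` bounds the length from below using arbitrary words. -/
theorem exists_simple_of_mem_canonicalGenerators {t : W}
    (ht : t ∈ cs.canonicalGenerators (cs.conjParabolic x J)) :
    ∃ i, t = x * cs.simple i * x⁻¹ := by
  obtain ⟨hrefl, hN⟩ := ht
  have htP : t ∈ cs.conjParabolic x J := (hN.ge (Set.mem_singleton t)).2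
  rw [mem_conjParabolic_iff] at htP
  have hr := cs.isReflection_inv_conj hrefl x
  set r := x⁻¹ * t * x with hrt
  have htr : t = x * r * x⁻¹ := by rw [hrt]; group
  have hr1 : r ≠ 1 := fun h ↦ by simpa [h] using hr.odd_length
  obtain ⟨i, hi⟩ := cs.exists_leftDescent_of_ne_one hr1
  have hinv : cs.IsLeftInversion r (cs.simple i) := ⟨cs.isReflection_simple i, hi⟩
  have hiJ := IsLeftInversion.mem_standardParabolic cs htP hinv
  refine ⟨i, (hN.le ⟨?_, cs.conj_mem_conjParabolic_iff.mpr hiJ⟩ :).symm⟩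
  rw [htr]
  exact (isLeftInversion_conj_iff hx htP hiJ (cs.isReflection_simple i)).mpr hinv

theorem conj_simple_mem_canonicalGenerators {i : B} (hi : i ∈ J) :
    x * cs.simple i * x⁻¹ ∈ cs.canonicalGenerators (cs.conjParabolic x J) := by
  have hiJ := cs.simple_mem_standardParabolic hi
  refine ⟨(cs.isReflection_simple i).conj x, Set.ext fun t ↦ ?_⟩
  constructor
  · rintro ⟨ht, htP⟩
    rw [mem_conjParabolic_iff] at htP
    have hr := cs.isReflection_inv_conj ht.1 x
    set r := x⁻¹ * t * x with hrt
    have htr : t = x * r * x⁻¹ := by rw [hrt]; group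
    rw [htr, isLeftInversion_conj_iff hx hiJ htP hr, isLeftInversion_simple_iff] at ht
    rw [htr, ht]
    rfl
  · rintro rfl
    exact ⟨(isLeftInversion_conj_iff hx hiJ hiJ (cs.isReflection_simple i)).mpr
      (cs.isLeftInversion_simple_iff.mpr rfl), cs.conj_mem_conjParabolic_iff.mpr hiJ⟩

/-- For `x` of minimal length in `x W_J`, conjugation by `x` identifies the length on `W_J` with
the length of `x W_J x⁻¹` relative to its canonical generators. -/
theorem lengthIn_conj {h : W} (hh : h ∈ cs.standardParabolic J) :
    cs.lengthIn (cs.conjParabolic x J) (x * h * x⁻¹) = cs.length h := by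
  have hprod : ∀ ω : List B, (ω.map fun i ↦ x * cs.simple i * x⁻¹).prod =
      x * cs.wordProd ω * x⁻¹ := by
    intro ω
    induction ω with
    | nil => simp
    | cons i ω ih => rw [List.map_cons, List.prod_cons, ih, wordProd_cons]; group
  obtain ⟨ω, hωJ, hω, hhω⟩ := cs.exists_isReduced_of_mem_standardParabolic hh
  have hmem : ω.length ∈ {n | ∃ l : List W,
      (∀ t ∈ l, t ∈ cs.canonicalGenerators (cs.conjParabolic x J)) ∧
        l.prod = x * h * x⁻¹ ∧ l.length = n} := by
    refine ⟨ω.map fun i ↦ x * cs.simple i * x⁻¹, fun t ht ↦ ?_, by rw [hprod, hhω], by simp⟩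
    obtain ⟨i, hi, rfl⟩ := List.mem_map.mp ht
    exact conj_simple_mem_canonicalGenerators hx (hωJ i hi)
  apply le_antisymm
  · rw [hhω, hω.eq, ← hhω]
    exact Nat.sInf_le hmem
  -- Nonemptiness matters here: `sInf` of the empty set would be 0.
  · obtain ⟨l, hl, hlp, hln⟩ := Nat.sInf_mem ⟨_, hmem⟩
    rw [lengthIn, ← hln]
    have hl' : l ∈ Set.range (List.map fun i ↦ x * cs.simple i * x⁻¹) := by
      rw [Set.range_list_map]
      exact fun t ht ↦ (exists_simple_of_mem_canonicalGenerators hx (hl t ht)).imp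
        fun _ h ↦ h.symm
    obtain ⟨ω', rfl⟩ := hl'
    rw [hprod, mul_left_inj, mul_right_inj] at hlp
    rw [← hlp, List.length_map]
    exact cs.length_wordProd_le ω'

end Minimal

/-- An involution is the longest element of its parabolic closure. -/
theorem isLongestElement_parabolicClosure [Finite W] {u : W} (hu : u ^ 2 = 1) :
    cs.IsLongestElement (cs.parabolicClosure u) u := by
  obtain ⟨x₀, a, J, hu₀, ha, hdesc, hcomm⟩ := cs.exists_conj_central_longest hu
  obtain ⟨y, hy, hmin⟩ := Set.exists_min_image (cs.standardParabolic J : Set W)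
    (fun y ↦ cs.length (x₀ * y)) (Set.toFinite _) ⟨1, one_mem _⟩
  have hx : ∀ h ∈ cs.standardParabolic J, cs.length (x₀ * y) ≤ cs.length (x₀ * y * h) :=
    fun h hh ↦ by rw [mul_assoc]; exact hmin _ (mul_mem hy hh)
  -- Passing to the minimal representative does not change the conjugate, as y commutes with a.
  have hux : u = x₀ * y * a * (x₀ * y)⁻¹ := by
    have hc := (cs.commute_of_mem_standardParabolic hcomm hy).eq
    rw [hu₀, mul_assoc x₀ y a, ← hc]
    group
  set x := x₀ * y
  rw [hux, cs.parabolicClosure_conj ha hdesc hcomm]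
  refine ⟨cs.conj_mem_conjParabolic_iff.mpr ha, ?_⟩
  rintro _ ⟨h, hh, rfl⟩ hne
  change x * h * x⁻¹ ≠ _ at hne
  change cs.lengthIn _ (x * h * x⁻¹) < _
  rw [lengthIn_conj hx hh, lengthIn_conj hx ha]
  exact cs.length_lt_of_mem_standardParabolic hdesc hh fun h' ↦ hne (h' ▸ rfl)

/-- Canonical generators are reflections, hence self-inverse, so reversing the list inverts its
product. -/
theorem exists_canonicalGenerators_prod_inv (P : Subgroup W) {x : W} {n : ℕ}
    (h : ∃ l : List W, (∀ t ∈ l, t ∈ cs.canonicalGenerators P) ∧ l.prod = x ∧ l.length = n) :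
    ∃ l : List W, (∀ t ∈ l, t ∈ cs.canonicalGenerators P) ∧ l.prod = x⁻¹ ∧ l.length = n := by
  obtain ⟨l, hl, rfl, rfl⟩ := h
  refine ⟨l.reverse, by simpa using hl, ?_, by simp⟩
  rw [List.prod_inv_reverse]
  congr 2
  exact ((List.map_congr_left fun t ht ↦ (hl t ht).1.inv).trans (List.map_id l)).symm

theorem lengthIn_inv (P : Subgroup W) (x : W) : cs.lengthIn P x⁻¹ = cs.lengthIn P x := by
  unfold lengthIn
  congr 1
  ext n
  refine ⟨fun h ↦ ?_, cs.exists_canonicalGenerators_prod_inv P⟩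
  have h' := cs.exists_canonicalGenerators_prod_inv P h
  rwa [inv_inv] at h'

variable {cs} in
theorem IsLongestElement.sq_eq_one {P : Subgroup W} {u : W} (h : cs.IsLongestElement P u) :
    u ^ 2 = 1 := by
  have hinv : u⁻¹ = u := by
    by_contra hne
    exact absurd (cs.lengthIn_inv P u) (h.2 _ (inv_mem h.1) hne).ne
  rw [pow_two]
  nth_rw 1 [← hinv]
  exact inv_mul_cancel u

variable {cs} in
theorem IsLongestElement.unique {P : Subgroup W} {u v : W} (hu : cs.IsLongestElement P u)
    (hv : cs.IsLongestElement P v) : u = v := by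
  by_contra hne
  exact lt_asymm (hu.2 v hv.1 (Ne.symm hne)) (hv.2 u hu.1 hne)

end CoxeterSystem

theorem mainTheorem9 {B W : Type*} [Group W] [Finite W] {M : CoxeterMatrix B}
    (cs : CoxeterSystem M W) :
    (∀ u : W, u ^ 2 = 1 ↔ cs.IsLongestElement (cs.parabolicClosure u) u) ∧
    (∀ P : Subgroup W, cs.IsInvolutive P →
      ∃! u : W, u ∈ P ∧ u ^ 2 = 1 ∧ P = cs.parabolicClosure u) := by
  refine ⟨fun u ↦ ⟨cs.isLongestElement_parabolicClosure, fun h ↦ h.sq_eq_one⟩, ?_⟩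
  rintro _ ⟨-, x, hx, rfl⟩
  have hlong := cs.isLongestElement_parabolicClosure hx
  refine ⟨x, ⟨hlong.1, hx, rfl⟩, ?_⟩
  rintro y ⟨-, hy, hxy⟩
  exact (hxy ▸ cs.isLongestElement_parabolicClosure hy).unique hlong
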